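/- Let $X=\{0,1\}$, let $X^*$ be the set of finite words over $X$, and let $\sigma=(0\,1)$ be the nontrivial permutation of $X$. For every integer $n>4$ and every choice of permutations $\sigma_{n,1},\dots,\sigma_{n,n-4}\in\mathrm{Sym}(X)$, let $\mathcal B^{(n)}$ be the $n$-state automaton over the alphabet $X$ with states $a_n,b_n,c_n,q_{n,1},\dots,q_{n,n-4},d_n$ given by $$a_n=(c_n,b_n),\quad b_n=(b_n,c_n),\quad c_n=(q_{n,1},q_{n,1})\sigma,$$ $$q_{n,i}=(q_{n,i+1},q_{n,i+1})\sigma_{n,i}\ (1\le i\le n-5),\quad q_{n,n-4}=(d_n,d_n)\sigma_{n,n-4},\quad d_n=(a_n,a_n)\sigma.$$ Here $t=(t_0,t_1)\tau$ means that the state $t$ acts on $X^*$ by fixing the empty word and by $t(xw)=\tau(x)\,t_x(w)$ for all $x\in X$, $w\in X^*$ (and $\tau$ is trivial if omitted). Then the group of permutations of $X^*$ generated by the actions of all $n$ states of $\mathcal B^{(n)}$ is isomorphic to the free product of $n$ copies of the cyclic group $C_2$ of order $2$. -/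

import Mathlib

/-- A Mealy automaton with set of states `Q` and alphabet `X`: `trans` is the transition
function and `out` is the output function. -/
structure MealyAutomaton (Q X : Type*) where
  trans : Q → X → Q
  out : Q → X → X

namespace MealyAutomaton

variable {Q X : Type*}

/-- The transformation of the set of finite words defined by the initial automaton with initial
state `q`: it outputs `out q x` on the first letter `x` and processes the rest of the word from
the state `trans q x`. -/
def run (A : MealyAutomaton Q X) : Q → List X → List X
  | _, [] => []
  | q, x :: w => A.out q x :: run A (A.trans q x) w

/-- An automaton is invertible if the output function of every state permutes the alphabet. -/
def IsInvertible (A : MealyAutomaton Q X) : Prop :=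
  ∀ q, Function.Bijective (A.out q)

theorem IsInvertible.run_bijective {A : MealyAutomaton Q X} (hA : A.IsInvertible) (q : Q) :
    Function.Bijective (A.run q) := by
  constructor
  · intro u
    induction u generalizing q with
    | nil => intro v h; cases v <;> simp_all [run]
    | cons x u ih =>
      intro v h
      cases v with
      | nil => simp [run] at h
      | cons y v =>
        simp only [run, List.cons.injEq] at h
        obtain rfl := (hA q).1 h.1
        rw [ih _ h.2]
  · intro u
    induction u generalizing q with
    | nil => exact ⟨[], rfl⟩
    | cons y u ih =>
      obtain ⟨x, rfl⟩ := (hA q).2 y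
      obtain ⟨w, rfl⟩ := ih (A.trans q x)
      exact ⟨x :: w, rfl⟩

/-- The permutation of the set of words defined by a state of an invertible automaton. -/
noncomputable def statePerm (A : MealyAutomaton Q X) (hA : A.IsInvertible) (q : Q) :
    Equiv.Perm (List X) :=
  Equiv.ofBijective (A.run q) (hA.run_bijective q)

/-- The group generated by an invertible automaton: the group of permutations of the set of words
generated by the transformations defined by all states. -/
noncomputable def group (A : MealyAutomaton Q X) (hA : A.IsInvertible) :
    Subgroup (Equiv.Perm (List X)) :=
  Subgroup.closure (Set.range (A.statePerm hA))

end MealyAutomaton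

/-- The states `a, b, c, q₁, …, qₙ₋₄, d`. The inserted states are indexed from `0`, that is,
`q i` stands for the state with index `i + 1` in the list above. -/
inductive BState (n : ℕ) : Type
  | a : BState n
  | b : BState n
  | c : BState n
  | q (i : Fin (n - 4)) : BState n
  | d : BState n

/-- The sequence `q 0, q 1, …, q (n - 5)` of inserted states, continued by `d`. -/
def BState.path (n k : ℕ) : BState n :=
  if h : k < n - 4 then BState.q ⟨k, h⟩ else BState.d

/-- The automaton over the alphabet `{0, 1}` with the wreath recursion
`a = (c, b)`, `b = (b, c)`, `c = (q₁, q₁)σ`, `qᵢ = (qᵢ₊₁, qᵢ₊₁)τᵢ` for `i < n - 4`,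
`qₙ₋₄ = (d, d)τₙ₋₄`, `d = (a, a)σ`, where `σ` is the transposition of `0` and `1`. -/
def bellaterra (n : ℕ) (τ : Fin (n - 4) → Equiv.Perm (Fin 2)) :
    MealyAutomaton (BState n) (Fin 2) where
  trans
    | .a, x => if x = 0 then .c else .b
    | .b, x => if x = 0 then .b else .c
    | .c, _ => BState.path n 0
    | .q i, _ => BState.path n (i + 1)
    | .d, _ => .a
  out
    | .a, x => x
    | .b, x => x
    | .c, x => Equiv.swap 0 1 x
    | .q i, x => τ i x
    | .d, x => Equiv.swap 0 1 x

theorem bellaterra_isInvertible (n : ℕ) (τ : Fin (n - 4) → Equiv.Perm (Fin 2)) :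
    (bellaterra n τ).IsInvertible := by
  intro q
  cases q with
  | a => exact Function.bijective_id
  | b => exact Function.bijective_id
  | c => exact (Equiv.swap (0 : Fin 2) 1).bijective
  | q i => exact (τ i).bijective
  | d => exact (Equiv.swap (0 : Fin 2) 1).bijective

/-! Every state acts as an involution, so it suffices that no nonempty reduced word of states (one
without equal neighbours) acts trivially. The dual automaton is invertible and there are finitely
many states, so trivial action is invariant under passing to sections and back
(`isTrivialWord_iff`). The core is that all reduced words of a given length are linked by sections
(`sectionEquiv_of_isChain`): since `c a b a b …` changes the first letter, no word of its length is
trivial.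

This transitivity goes by induction on length. Assume it for length `k + 1`, and let `B` be the
section-invariant set of reduced words of length `k + 2` not equivalent to `d a d … b`, supposed
nonempty. After a word in `a` and `d`, all letters other than these two give equivalent results
(`append_equiv_append_b`), so `d a d …` extends into `B` only by continuing the alternation. By
transitivity every reduced word of length `k + 1` has exactly one extension in `B`, and all factors
of `dadada…` of length `k + 2` lie in `B`. Repeated sections of this infinite word keep its factors
in `B` but double its period each time, by a parity count (`IsOddWord.infiniteRun`), while
determinism keeps the period bounded (`periodic_half_of_deterministic`). -/

namespace MealyAutomaton

/-! ### Duality and section equivalence -/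

variable {Q X : Type*}

/-- The dual automaton, in which states and letters exchange their roles. -/
def dual (A : MealyAutomaton Q X) : MealyAutomaton X Q where
  trans x q := A.out q x
  out x q := A.trans q x

/-- The action of a word of states; the first state of the word acts first. -/
def act (A : MealyAutomaton Q X) : List Q → List X → List X
  | [], v => v
  | q :: w, v => act A w (A.run q v)

@[simp]
theorem length_run (A : MealyAutomaton Q X) (q : Q) (v : List X) :
    (A.run q v).length = v.length := by
  induction v generalizing q with
  | nil => rfl
  | cons x v ih => simp [run, ih]

theorem exists_act_cons (A : MealyAutomaton Q X) (w : List Q) (x : X) (v : List X) :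
    ∃ y, A.act w (x :: v) = y :: A.act (A.dual.run x w) v := by
  induction w generalizing x v with
  | nil => exact ⟨x, rfl⟩
  | cons q w ih => exact ih (A.out q x) (A.run (A.trans q x) v)

theorem act_append (A : MealyAutomaton Q X) (w w' : List Q) (v : List X) :
    A.act (w ++ w') v = A.act w' (A.act w v) := by
  induction w generalizing v with
  | nil => rfl
  | cons q w ih => exact ih _

/-- A word of states is trivial if it acts as the identity. -/
def IsTrivialWord (A : MealyAutomaton Q X) (w : List Q) : Prop :=
  ∀ v, A.act w v = v

theorem IsTrivialWord.dual_run {A : MealyAutomaton Q X} {w : List Q} (h : A.IsTrivialWord w)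
    (x : X) : A.IsTrivialWord (A.dual.run x w) := by
  intro v
  obtain ⟨y, hy⟩ := A.exists_act_cons w x v
  rw [h] at hy
  exact (List.cons.inj hy).2.symm

theorem IsTrivialWord.of_dual_run [Finite Q] {A : MealyAutomaton Q X}
    (hA : A.dual.IsInvertible) {w : List Q} {x : X} (h : A.IsTrivialWord (A.dual.run x w)) :
    A.IsTrivialWord w := by
  let f : {v : List Q // v.length = w.length} → {v : List Q // v.length = w.length} :=
    fun v => ⟨A.dual.run x v.1, by rw [length_run, v.2]⟩
  have hf : Function.Injective f := fun u v huv =>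
    Subtype.ext ((hA.run_bijective x).1 (congrArg Subtype.val huv))
  have : Finite {v : List Q // v.length = w.length} := List.finite_length_eq Q w.length
  -- The section at `x` permutes the finite set of words of this length, so `w` is itself an
  -- iterated section of its own section.
  obtain ⟨m, hm, hp⟩ := hf.mem_periodicPts ⟨w, rfl⟩
  have key : ∀ (m : ℕ) (v), A.IsTrivialWord v.1 → A.IsTrivialWord (f^[m] v).1 := by
    intro m
    induction m with
    | zero => exact fun v hv => hv
    | succ m ih => exact fun v hv => ih (f v) (hv.dual_run x)
  obtain ⟨m, rfl⟩ := Nat.exists_eq_add_one_of_ne_zero hm.ne'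
  have := key m (f ⟨w, rfl⟩) h
  rwa [← Function.iterate_succ_apply, hp] at this

/-- The equivalence of words of states generated by passing to sections at letters. -/
def SectionEquiv (A : MealyAutomaton Q X) : List Q → List Q → Prop :=
  Relation.EqvGen fun w w' => ∃ x, A.dual.run x w = w'

namespace SectionEquiv

variable {A : MealyAutomaton Q X} {u v w : List Q}

theorem refl (w : List Q) : A.SectionEquiv w w := Relation.EqvGen.refl w

theorem symm (h : A.SectionEquiv u v) : A.SectionEquiv v u := Relation.EqvGen.symm _ _ h

theorem trans (h : A.SectionEquiv u v) (h' : A.SectionEquiv v w) : A.SectionEquiv u w :=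
  Relation.EqvGen.trans _ _ _ h h'

theorem run (x : X) (w : List Q) : A.SectionEquiv w (A.dual.run x w) :=
  Relation.EqvGen.rel _ _ ⟨x, rfl⟩

theorem iff_of_invariant {P : List Q → Prop} (hP : ∀ x w, P (A.dual.run x w) ↔ P w)
    (h : A.SectionEquiv u v) : P u ↔ P v := by
  induction h with
  | rel u v h => obtain ⟨x, rfl⟩ := h; exact (hP x u).symm
  | refl => exact Iff.rfl
  | symm _ _ _ ih => exact ih.symm
  | trans _ _ _ _ _ ih ih' => exact ih.trans ih'

theorem isTrivialWord_iff [Finite Q] (hA : A.dual.IsInvertible) (h : A.SectionEquiv u v) :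
    A.IsTrivialWord u ↔ A.IsTrivialWord v :=
  h.iff_of_invariant fun x _ => ⟨fun h => h.of_dual_run hA, fun h => h.dual_run x⟩

end SectionEquiv

/-- The state reached by an automaton after reading a word. -/
def runState (A : MealyAutomaton Q X) : Q → List X → Q
  | q, [] => q
  | q, x :: v => runState A (A.trans q x) v

theorem run_append_singleton (A : MealyAutomaton Q X) (q : Q) (v : List X) (x : X) :
    A.run q (v ++ [x]) = A.run q v ++ [A.out (A.runState q v) x] := by
  induction v generalizing q with
  | nil => rfl
  | cons y v ih => simp [run, runState, ih]

end MealyAutomaton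

/-! ### Infinite words, determinism and periods -/

/-- The factor of length `k` of an infinite word that starts at position `i`. -/
def factor {α : Type*} (z : ℕ → α) : ℕ → ℕ → List α
  | _, 0 => []
  | i, k + 1 => z i :: factor z (i + 1) k

section factor

variable {α : Type*} (z : ℕ → α)

@[simp]
theorem length_factor (i k : ℕ) : (factor z i k).length = k := by
  induction k generalizing i with
  | zero => rfl
  | succ k ih => simp [factor, ih]

theorem factor_succ (i k : ℕ) : factor z i (k + 1) = factor z i k ++ [z (i + k)] := by
  induction k generalizing i with
  | zero => rfl
  | succ k ih =>
    rw [factor, ih, factor, List.cons_append, Nat.add_right_comm, Nat.add_assoc]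

theorem mem_factor {i k : ℕ} {s : α} (h : s ∈ factor z i k) : ∃ j, z j = s := by
  induction k generalizing i with
  | zero => simp [factor] at h
  | succ k ih =>
    rcases List.mem_cons.1 h with rfl | h
    · exact ⟨i, rfl⟩
    · exact ih h

theorem isChain_factor (hz : ∀ i, z i ≠ z (i + 1)) (i k : ℕ) :
    (factor z i k).IsChain (· ≠ ·) := by
  induction k generalizing i with
  | zero => exact List.isChain_nil
  | succ k ih =>
    cases k with
    | zero => exact List.isChain_singleton _
    | succ k => exact List.isChain_cons_cons.2 ⟨hz i, ih (i + 1)⟩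

/-- If every letter of a periodic infinite word is determined by the `k` preceding ones, and the
period is a power of two greater than the number of words of length `k`, then the period can be
halved. -/
theorem periodic_half_of_deterministic [Finite α] {j k : ℕ}
    (hdet : ∀ i i', factor z i k = factor z i' k → z (i + k) = z (i' + k))
    (hper : Function.Periodic z (2 ^ (j + 1)))
    (hcard : Nat.card {v : List α // v.length = k} < 2 ^ (j + 1)) :
    Function.Periodic z (2 ^ j) := by
  have : Finite {v : List α // v.length = k} := List.finite_length_eq α k
  have : Fintype {v : List α // v.length = k} := Fintype.ofFinite _
  rw [Nat.card_eq_fintype_card] at hcard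
  obtain ⟨i, i', hne, heq⟩ := Fintype.exists_ne_map_eq_of_card_lt
    (fun i : Fin (2 ^ (j + 1)) => (⟨factor z i k, length_factor z i k⟩ :
      {v : List α // v.length = k})) (by simpa using hcard)
  wlog hlt : i < i' generalizing i i'
  · exact this i' i hne.symm heq.symm (lt_of_le_of_ne (not_lt.1 hlt) hne.symm)
  have heq : factor z i k = factor z i' k := congrArg Subtype.val heq
  have hstep : ∀ t, factor z (i + t) k = factor z (i' + t) k := by
    intro t
    induction t with
    | zero => exact heq
    | succ t ih =>
      have h : factor z (i + t) (k + 1) = factor z (i' + t) (k + 1) := by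
        rw [factor_succ, factor_succ, ih, hdet _ _ ih]
      exact (List.cons.inj h).2
  have hmul : ∀ (m t : ℕ), z (t + m * 2 ^ (j + 1)) = z t := fun m t => by
    simpa using hper.nat_mul m t
  obtain ⟨p, hp⟩ := Nat.exists_eq_add_of_lt hlt
  have hpp : Function.Periodic z (p + 1) := by
    intro t
    -- Adding `k + i` full periods moves `t` past position `i + k`, where `hstep` applies; hence the
    -- word is purely periodic.
    obtain ⟨q, hq⟩ := Nat.exists_eq_add_of_le (Nat.one_le_two_pow (n := j + 1))
    rw [hq] at hmul
    rw [← hmul (k + i) t, ← hmul (k + i) (t + (p + 1))]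
    convert (hdet _ _ (hstep (t + (k + i) * q))).symm using 2
    · rw [hp]; ring
    · ring
  -- As `p + 1 < 2 ^ (j + 1)`, its 2-part divides `2 ^ j`; so some multiple of `p + 1` is an odd
  -- multiple of `2 ^ j`, that is, `2 ^ j` modulo the full period.
  obtain ⟨r, o, ho, hro⟩ := Nat.exists_eq_two_pow_mul_odd (Nat.succ_ne_zero p)
  have hr : r ≤ j := by
    have h1 : 2 ^ r ≤ p + 1 := Nat.le_of_dvd (Nat.succ_pos p) ⟨o, hro⟩
    have h2 : 2 ^ r < 2 ^ (j + 1) := by have := i'.2; omega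
    have := (Nat.pow_lt_pow_iff_right (a := 2) (by norm_num)).1 h2
    omega
  obtain ⟨m, rfl⟩ := ho
  obtain ⟨d, rfl⟩ := Nat.exists_eq_add_of_le hr
  intro t
  have h := hpp.nat_mul (2 ^ d) t
  rw [← hmul m (t + 2 ^ (r + d)), ← h]
  congr 1
  rw [Nat.succ_eq_add_one] at hro
  push_cast
  rw [hro]
  ring

end factor

namespace MealyAutomaton

variable {Q X : Type*}

/-- The sequence of states of an automaton that processes an infinite word. -/
def stateSeq (A : MealyAutomaton Q X) (q : Q) (z : ℕ → X) : ℕ → Q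
  | 0 => q
  | i + 1 => A.trans (stateSeq A q z i) (z i)

/-- The image of an infinite word under an initial automaton. -/
def infiniteRun (A : MealyAutomaton Q X) (q : Q) (z : ℕ → X) (i : ℕ) : X :=
  A.out (A.stateSeq q z i) (z i)

theorem run_factor (A : MealyAutomaton Q X) (q : Q) (z : ℕ → X) (i k : ℕ) :
    A.run (A.stateSeq q z i) (factor z i k) = factor (A.infiniteRun q z) i k := by
  induction k generalizing i with
  | zero => rfl
  | succ k ih => exact congrArg (_ :: ·) (ih (i + 1))

end MealyAutomaton

/-! ### The states and the invertibility of the dual -/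

namespace BState

variable {n : ℕ}

/-- The states are the inserted states and four further ones. -/
def equivSum (n : ℕ) : BState n ≃ Fin (n - 4) ⊕ Fin 4 where
  toFun
    | .a => .inr 0
    | .b => .inr 1
    | .c => .inr 2
    | .d => .inr 3
    | .q i => .inl i
  invFun
    | .inr 0 => .a
    | .inr 1 => .b
    | .inr 2 => .c
    | .inr 3 => .d
    | .inl i => .q i
  left_inv s := by cases s <;> rfl
  right_inv s := by
    rcases s with i | i
    · rfl
    · fin_cases i <;> rfl

instance : Finite (BState n) := Finite.of_equiv _ (equivSum n).symm

/-- The transposition of the states `a` and `b`. -/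
def swapAB : BState n → BState n
  | .a => .b
  | .b => .a
  | s => s

/-- The transposition of the states `b` and `c`. -/
def swapBC : BState n → BState n
  | .b => .c
  | .c => .b
  | s => s

/-- The transposition of the states `a` and `c`. -/
def swapAC : BState n → BState n
  | .a => .c
  | .c => .a
  | s => s

theorem path_eq_q {k : ℕ} (h : k < n - 4) : path n k = .q ⟨k, h⟩ := dif_pos h

theorem path_eq_d {k : ℕ} (h : ¬k < n - 4) : path n k = .d := dif_neg h

theorem path_ne (k : ℕ) : path n k ≠ .a ∧ path n k ≠ .b ∧ path n k ≠ .c := by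
  unfold path
  split_ifs <;> simp

theorem swapBC_path (k : ℕ) : swapBC (path n k) = path n k := by
  unfold path
  split_ifs <;> rfl

theorem path_zero_ne_path_succ (i : Fin (n - 4)) : path n 0 ≠ path n (i + 1) := by
  have h0 : 0 < n - 4 := by have := i.2; omega
  rw [path_eq_q h0]
  unfold path
  split_ifs <;> simp

theorem path_succ_injective {i j : Fin (n - 4)} (h : path n (i + 1) = path n (j + 1)) : i = j := by
  have hi := i.2
  have hj := j.2
  unfold path at h
  split_ifs at h
  · simpa [Fin.ext_iff] using h
  · ext; omega

end BState

open BState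

variable {n : ℕ} {τ : Fin (n - 4) → Equiv.Perm (Fin 2)}

theorem bellaterra_trans_injective (x : Fin 2) :
    Function.Injective fun s => (bellaterra n τ).trans s x := by
  intro s t h
  have hp := fun k => path_ne (n := n) k
  have hp' := fun k => (path_ne (n := n) k).1.symm
  have hp'' := fun k => (path_ne (n := n) k).2.1.symm
  have hp''' := fun k => (path_ne (n := n) k).2.2.symm
  have h0 := path_zero_ne_path_succ (n := n)
  have h0' := fun i => (path_zero_ne_path_succ (n := n) i).symm
  fin_cases x <;> cases s <;> cases t <;>
    first
    | rfl
    | (simp [bellaterra, hp, hp', hp'', hp''', h0, h0'] at h; done)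
    | (simp only [bellaterra] at h; rw [path_succ_injective h])

theorem bellaterra_dual_isInvertible : (bellaterra n τ).dual.IsInvertible := fun x =>
  Finite.injective_iff_bijective.1 (bellaterra_trans_injective (τ := τ) x)

/-- Only `a` and `b` have two different sections, and these two states fix the letters. This makes
every state an involution. -/
theorem bellaterra_trans_out (s : BState n) (x : Fin 2) :
    (bellaterra n τ).trans s ((bellaterra n τ).out s x) = (bellaterra n τ).trans s x := by
  cases s <;> rfl

theorem perm_fin_two_apply_apply (e : Equiv.Perm (Fin 2)) (x : Fin 2) : e (e x) = x := by
  revert e x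
  decide

theorem bellaterra_out_out (s : BState n) (x : Fin 2) :
    (bellaterra n τ).out s ((bellaterra n τ).out s x) = x := by
  cases s
  case q i => exact perm_fin_two_apply_apply (τ i) x
  all_goals first | rfl | exact Equiv.swap_apply_self _ _ _

theorem bellaterra_run_run (s : BState n) (v : List (Fin 2)) :
    (bellaterra n τ).run s ((bellaterra n τ).run s v) = v := by
  induction v generalizing s with
  | nil => rfl
  | cons x v ih =>
    simp only [MealyAutomaton.run, bellaterra_trans_out, bellaterra_out_out, ih]

/-- The section of a word of states at a letter. -/
local notation "D" => MealyAutomaton.run (MealyAutomaton.dual (bellaterra n τ))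

local infix:50 " ≈ₛ " => MealyAutomaton.SectionEquiv (bellaterra n τ)

/-- By `bellaterra_trans_out`, neighbouring letters are in effect replaced by their sections at the
same letter, and taking sections there is injective. -/
theorem isChain_section_iff (x : Fin 2) (w : List (BState n)) :
    (D x w).IsChain (· ≠ ·) ↔ w.IsChain (· ≠ ·) := by
  induction w generalizing x with
  | nil => rfl
  | cons s w ih =>
    cases w with
    | nil => simp [MealyAutomaton.run]
    | cons t w =>
      have h := ih ((bellaterra n τ).out s x)
      simp only [MealyAutomaton.run, List.isChain_cons_cons] at h ⊢
      refine and_congr (not_congr ?_) h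
      change (bellaterra n τ).trans s x = (bellaterra n τ).trans t ((bellaterra n τ).out s x) ↔ _
      rw [← bellaterra_trans_out]
      exact (bellaterra_trans_injective _).eq_iff

theorem bellaterra_out_cases (s : BState n) :
    ((bellaterra n τ).out s 0 = 0 ∧ (bellaterra n τ).out s 1 = 1) ∨
      ((bellaterra n τ).out s 0 = 1 ∧ (bellaterra n τ).out s 1 = 0) := by
  cases s
  case q i =>
    exact (by decide : ∀ e : Equiv.Perm (Fin 2), e 0 = 0 ∧ e 1 = 1 ∨ e 0 = 1 ∧ e 1 = 0) (τ i)
  all_goals simp [bellaterra]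

theorem section_cons (x : Fin 2) (s : BState n) (w : List (BState n)) :
    D x (s :: w) = (bellaterra n τ).trans s x :: D ((bellaterra n τ).out s x) w := rfl

/-! ### Substitutions of letters that preserve section equivalence -/

theorem section_map_swapAB (w : List (BState n)) :
    D 0 (w.map swapAB) = D 1 w ∧ D 1 (w.map swapAB) = D 0 w := by
  induction w with
  | nil => exact ⟨rfl, rfl⟩
  | cons s w ih =>
    have h0 : (bellaterra n τ).trans (swapAB s) 0 = (bellaterra n τ).trans s 1 := by cases s <;> rfl
    have h1 : (bellaterra n τ).trans (swapAB s) 1 = (bellaterra n τ).trans s 0 := by cases s <;> rfl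
    have h : (bellaterra n τ).out (swapAB s) = (bellaterra n τ).out s := by cases s <;> rfl
    simp only [List.map_cons, section_cons, h0, h1, h]
    rcases bellaterra_out_cases (τ := τ) s with h | h <;> simp only [h, ih, and_self]

theorem map_swapBC_section (w : List (BState n)) :
    (D 0 w).map swapBC = D 1 w ∧ (D 1 w).map swapBC = D 0 w := by
  induction w with
  | nil => exact ⟨rfl, rfl⟩
  | cons s w ih =>
    have h : swapBC ((bellaterra n τ).trans s 0) = (bellaterra n τ).trans s 1 ∧
        swapBC ((bellaterra n τ).trans s 1) = (bellaterra n τ).trans s 0 := by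
      cases s <;> first | exact ⟨rfl, rfl⟩ | exact ⟨swapBC_path _, swapBC_path _⟩
    simp only [List.map_cons, section_cons, h]
    rcases bellaterra_out_cases (τ := τ) s with h | h <;> simp only [h, ih, and_self]

theorem sectionEquiv_map_swapAB (w : List (BState n)) : w ≈ₛ w.map swapAB :=
  (MealyAutomaton.SectionEquiv.run 1 w).trans <|
    (section_map_swapAB w).1 ▸ (MealyAutomaton.SectionEquiv.run 0 (w.map swapAB)).symm

theorem sectionEquiv_map_swapBC (w : List (BState n)) : w ≈ₛ w.map swapBC := by
  obtain ⟨w, rfl⟩ := (bellaterra_dual_isInvertible (τ := τ).run_bijective 0).2 w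
  rw [(map_swapBC_section w).1]
  exact (MealyAutomaton.SectionEquiv.run 0 w).symm.trans (MealyAutomaton.SectionEquiv.run 1 w)

theorem sectionEquiv_map_swapAC (w : List (BState n)) : w ≈ₛ w.map swapAC := by
  have h : (swapAC : BState n → BState n) = swapAB ∘ swapBC ∘ swapAB := by
    funext s; cases s <;> rfl
  rw [h, ← List.map_map, ← List.map_map]
  exact (sectionEquiv_map_swapAB w).trans <|
    (sectionEquiv_map_swapBC _).trans (sectionEquiv_map_swapAB _)

/-- The permutation of the states that fixes `b` and `c` and cyclically permutes
`a, q₁, …, qₙ₋₄, d`. -/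
def rotate (n : ℕ) : BState n → BState n
  | .a => path n 0
  | .b => .b
  | .c => .c
  | .q i => path n (i + 1)
  | .d => .a

theorem rotate_eq (s : BState n) : rotate n s = (bellaterra n τ).trans (swapAC s) 0 := by
  cases s <;> rfl

theorem rotate_bijective (n : ℕ) : Function.Bijective (rotate n) := by
  refine Finite.injective_iff_bijective.1 fun s t h => ?_
  rw [rotate_eq (τ := 1), rotate_eq (τ := 1)] at h
  have h := bellaterra_trans_injective 0 h
  cases s <;> cases t <;> simp_all [swapAC]

/-- Without `b` and `c`, the word after the swap contains no `a` or `b`, so its sections do not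
depend on the letters read. -/
theorem section_map_swapAC {u : List (BState n)} (hb : .b ∉ u) (hc : .c ∉ u) (x : Fin 2) :
    D x (u.map swapAC) = u.map (rotate n) := by
  induction u generalizing x with
  | nil => rfl
  | cons s u ih =>
    simp only [List.mem_cons, not_or] at hb hc
    simp only [List.map_cons, MealyAutomaton.run, ih hb.2 hc.2]
    congr 1
    cases s <;> first | exact absurd rfl hb.1 | exact absurd rfl hc.1 | rfl

theorem append_b_equiv_append_c {u : List (BState n)} (hb : .b ∉ u) (hc : .c ∉ u) :
    u ++ [.b] ≈ₛ u ++ [.c] := by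
  convert sectionEquiv_map_swapBC (u ++ [.b]) using 1
  have h : u.map swapBC = u := by
    conv_rhs => rw [← List.map_id u]
    refine List.map_congr_left fun s hs => ?_
    cases s <;> first | exact absurd hs hb | exact absurd hs hc | rfl
  simp [h, swapBC]

/-- Transports the property of `s` along `rotate`. Starting from `a`, where it comes from `swapAB`,
it reaches all inserted states and `d`. -/
theorem append_equiv_append_b_rotate {s : BState n} (hs : s ≠ .b ∧ s ≠ .c)
    (h : ∀ u : List (BState n), .b ∉ u → .c ∉ u → s ∉ u → u ++ [s] ≈ₛ u ++ [.b])
    {u : List (BState n)} (hb : .b ∉ u) (hc : .c ∉ u) (hu : rotate n s ∉ u) :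
    u ++ [rotate n s] ≈ₛ u ++ [.b] := by
  obtain ⟨u, rfl⟩ := (rotate_bijective n).2.list_map u
  replace hb : .b ∉ u := fun h => hb (List.mem_map_of_mem (f := rotate n) h)
  replace hc : .c ∉ u := fun h => hc (List.mem_map_of_mem (f := rotate n) h)
  replace hu : s ∉ u := fun h => hu (List.mem_map_of_mem (f := rotate n) h)
  have key : ∀ t : BState n, u ++ [t] ≈ₛ D 0 ((u ++ [t]).map swapAC) := fun t =>
    (sectionEquiv_map_swapAC _).trans (MealyAutomaton.SectionEquiv.run 0 _)
  have h1 : D 0 ((u ++ [s]).map swapAC) = u.map (rotate n) ++ [rotate n s] := by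
    rw [section_map_swapAC, List.map_append, List.map_singleton] <;>
    simp [hb, hc, hs.1.symm, hs.2.symm]
  -- `swapAC` fixes `b`, whose section is `b` or `c` according to the letter arriving there; the two
  -- outcomes are equivalent.
  have h2 : D 0 ((u ++ [BState.b]).map swapAC) = u.map (rotate n) ++ [.b] ∨
      D 0 ((u ++ [BState.b]).map swapAC) = u.map (rotate n) ++ [.c] := by
    rw [List.map_append, List.map_singleton, MealyAutomaton.run_append_singleton,
      section_map_swapAC hb hc]
    generalize (bellaterra n τ).dual.runState 0 (u.map swapAC) = x
    fin_cases x
    · exact Or.inl rfl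
    · exact Or.inr rfl
  have hrb : BState.b ∉ u.map (rotate n) := fun h => hb <|
    (List.mem_map_of_injective (rotate_bijective n).1 (a := .b)).1 h
  have hrc : BState.c ∉ u.map (rotate n) := fun h => hc <|
    (List.mem_map_of_injective (rotate_bijective n).1 (a := .c)).1 h
  rw [← h1]
  refine (key s).symm.trans ((h u hb hc hu).trans ((key .b).trans ?_))
  rcases h2 with h2 | h2
  · rw [h2]; exact .refl _
  · rw [h2]; exact (append_b_equiv_append_c hrb hrc).symm

theorem append_a_equiv_append_b {u : List (BState n)} (hb : .b ∉ u) (ha : .a ∉ u) :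
    u ++ [.a] ≈ₛ u ++ [.b] := by
  convert sectionEquiv_map_swapAB (u ++ [.a]) using 1
  have h : u.map swapAB = u := by
    conv_rhs => rw [← List.map_id u]
    refine List.map_congr_left fun s hs => ?_
    cases s <;> first | exact absurd hs hb | exact absurd hs ha | rfl
  simp [h, swapAB]

theorem append_path_equiv_append_b {k : ℕ} (hk : k ≤ n - 4) {u : List (BState n)}
    (hb : .b ∉ u) (hc : .c ∉ u) (hu : path n k ∉ u) : u ++ [path n k] ≈ₛ u ++ [.b] := by
  induction k generalizing u with
  | zero =>
    exact append_equiv_append_b_rotate (s := .a) (by simp)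
      (fun u hb _ ha => append_a_equiv_append_b hb ha) hb hc hu
  | succ k ih =>
    have h := path_eq_q (n := n) (k := k) (by omega)
    have hr : rotate n (path n k) = path n (k + 1) := by rw [h]; rfl
    rw [← hr] at hu ⊢
    exact append_equiv_append_b_rotate (path_ne k).2
      (fun u hb hc hu => ih (by omega) hb hc hu) hb hc hu

/-- If a word does not contain `b`, `c` and `s`, then it can be continued by `s` and by `b` with
equivalent results. -/
theorem append_equiv_append_b {s : BState n} {u : List (BState n)}
    (hb : .b ∉ u) (hc : .c ∉ u) (hs : s ∉ u) : u ++ [s] ≈ₛ u ++ [.b] := by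
  cases s with
  | a => exact append_a_equiv_append_b hb hs
  | b => exact .refl _
  | c => exact (append_b_equiv_append_c hb hc).symm
  | q i =>
    have h := path_eq_q i.2
    rw [← h] at hs ⊢
    exact append_path_equiv_append_b i.2.le hb hc hs
  | d =>
    have h := path_eq_d (n := n) (lt_irrefl (n - 4))
    rw [← h] at hs ⊢
    exact append_path_equiv_append_b le_rfl hb hc hs

/-! ### Odd words and period doubling -/

/-- The parity of a state: it is `1` at the states that swap the letters. -/
def parity (τ : Fin (n - 4) → Equiv.Perm (Fin 2)) (s : BState n) : Fin 2 :=
  (bellaterra n τ).out s 0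

/-- The indicator function of the states `a` and `b`. -/
def indicatorAB : BState n → Fin 2
  | .a => 1
  | .b => 1
  | _ => 0

theorem fin_two_add_self (x : Fin 2) : x + x = 0 := by
  revert x
  decide

theorem fin_two_add_one_add_one (x : Fin 2) : x + 1 + 1 = x := by
  revert x
  decide

theorem out_eq_add_parity (s : BState n) (x : Fin 2) :
    (bellaterra n τ).out s x = x + parity τ s := by
  unfold parity
  rcases bellaterra_out_cases (τ := τ) s with h | h <;> fin_cases x <;> simp [h]

/-- States other than `a` and `b` have equal sections, which cancel modulo 2. The sections of `a`
and `b` are `b` and `c`: exactly one is counted here, and exactly one swaps letters, as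
`parity_trans` needs. Hence the choice of `τ` is immaterial. -/
theorem indicatorAB_trans (s : BState n) (x : Fin 2) :
    indicatorAB ((bellaterra n τ).trans s x) + indicatorAB ((bellaterra n τ).trans s (x + 1)) =
      indicatorAB s := by
  cases s
  case c => exact fin_two_add_self _
  case q i => exact fin_two_add_self _
  case d => exact fin_two_add_self _
  all_goals fin_cases x <;> rfl

theorem parity_trans (s : BState n) (x : Fin 2) :
    parity τ ((bellaterra n τ).trans s x) + parity τ ((bellaterra n τ).trans s (x + 1)) =
      indicatorAB s := by
  cases s
  case c => exact fin_two_add_self _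
  case q i => exact fin_two_add_self _
  case d => exact fin_two_add_self _
  all_goals fin_cases x <;> simp [parity, bellaterra, indicatorAB]

/-- An infinite word of states is odd of level `j` if it has period `2 ^ (j + 1)`, and a period
contains an odd number of states that swap the letters, and an odd number of occurrences of `a`
and `b`. -/
structure IsOddWord (τ : Fin (n - 4) → Equiv.Perm (Fin 2)) (j : ℕ) (z : ℕ → BState n) :
    Prop where
  periodic : Function.Periodic z (2 ^ (j + 1))
  sum_parity : ∑ i ∈ Finset.range (2 ^ (j + 1)), parity τ (z i) = 1
  sum_indicatorAB : ∑ i ∈ Finset.range (2 ^ (j + 1)), indicatorAB (z i) = 1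

theorem stateSeq_eq_sum (z : ℕ → BState n) (i : ℕ) :
    (bellaterra n τ).dual.stateSeq 0 z i = ∑ t ∈ Finset.range i, parity τ (z t) := by
  induction i with
  | zero => rfl
  | succ i ih =>
    rw [Finset.sum_range_succ, ← ih, ← out_eq_add_parity]
    rfl

namespace IsOddWord

variable {j : ℕ} {z : ℕ → BState n}

/-- An odd number of swaps per period flips the letter, so consecutive periods are read with
opposite letters. -/
theorem stateSeq_add (h : IsOddWord τ j z) (i : ℕ) :
    (bellaterra n τ).dual.stateSeq 0 z (2 ^ (j + 1) + i) =
      (bellaterra n τ).dual.stateSeq 0 z i + 1 := by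
  rw [stateSeq_eq_sum, stateSeq_eq_sum, Finset.sum_range_add, h.sum_parity, add_comm]
  congr 1
  exact Finset.sum_congr rfl fun t _ => by rw [add_comm, h.periodic]

theorem infiniteRun_add (h : IsOddWord τ j z) (i : ℕ) :
    (bellaterra n τ).dual.infiniteRun 0 z (2 ^ (j + 1) + i) =
      (bellaterra n τ).trans (z i) ((bellaterra n τ).dual.stateSeq 0 z i + 1) := by
  unfold MealyAutomaton.infiniteRun
  rw [h.stateSeq_add, add_comm _ i, h.periodic]
  rfl

/-- Over the doubled period both sections of each `z i` occur once, so their contributions pair up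
to `indicatorAB (z i)`. -/
theorem sum_infiniteRun (h : IsOddWord τ j z) (f : BState n → Fin 2)
    (hf : ∀ s x, f ((bellaterra n τ).trans s x) + f ((bellaterra n τ).trans s (x + 1)) =
      indicatorAB s) :
    ∑ i ∈ Finset.range (2 ^ (j + 1 + 1)), f ((bellaterra n τ).dual.infiniteRun 0 z i) = 1 := by
  rw [pow_succ, mul_two, Finset.sum_range_add, ← Finset.sum_add_distrib, ← h.sum_indicatorAB]
  refine Finset.sum_congr rfl fun i _ => ?_
  rw [h.infiniteRun_add]
  exact hf _ _

protected theorem infiniteRun (h : IsOddWord τ j z) :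
    IsOddWord τ (j + 1) ((bellaterra n τ).dual.infiniteRun 0 z) where
  periodic i := by
    have h1 : i + 2 ^ (j + 1 + 1) = 2 ^ (j + 1) + (2 ^ (j + 1) + i) := by ring
    rw [h1, h.infiniteRun_add, h.stateSeq_add, add_comm _ i, h.periodic, fin_two_add_one_add_one]
    rfl
  sum_parity := h.sum_infiniteRun _ parity_trans
  sum_indicatorAB := h.sum_infiniteRun _ indicatorAB_trans

theorem not_periodic (h : IsOddWord τ j z) : ¬Function.Periodic z (2 ^ j) := by
  intro hz
  have h1 := h.sum_indicatorAB
  rw [pow_succ, mul_two, Finset.sum_range_add, ← Finset.sum_add_distrib] at h1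
  simp only [add_comm _, hz _, fin_two_add_self, Finset.sum_const_zero] at h1
  exact absurd h1 (by decide)

end IsOddWord

/-- A set of words of states that is invariant under sections and contains all factors of length
`k + 1` of an odd word does not determine the last letter of its elements by the `k` preceding
ones. -/
theorem not_deterministic_of_factor {B : List (BState n) → Prop} (hB : ∀ x w, B w → B (D x w))
    {z : ℕ → BState n} (hz : IsOddWord τ 0 z) {k : ℕ} (hzB : ∀ i, B (factor z i (k + 1))) :
    ¬∀ u y y', u.length = k → B (u ++ [y]) → B (u ++ [y']) → y = y' := by
  intro hdet
  have key : ∀ j, ∃ z, IsOddWord τ j z ∧ ∀ i, B (factor z i (k + 1)) := by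
    intro j
    induction j with
    | zero => exact ⟨z, hz, hzB⟩
    | succ j ih =>
      obtain ⟨z, hz, hzB⟩ := ih
      exact ⟨_, hz.infiniteRun, fun i => MealyAutomaton.run_factor _ _ z i _ ▸ hB _ _ (hzB i)⟩
  -- The level is the number `N` of words of length `k`, because `N < 2 ^ (N + 1)`.
  obtain ⟨z, hz, hzB⟩ := key (Nat.card {v : List (BState n) // v.length = k})
  refine hz.not_periodic (periodic_half_of_deterministic z (fun i i' h => ?_) hz.periodic
    (Nat.lt_two_pow_self.trans (Nat.pow_lt_pow_right (by norm_num) (Nat.lt_succ_self _))))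
  have h1 := hzB i
  have h2 := hzB i'
  rw [factor_succ] at h1 h2
  rw [← h] at h2
  exact hdet _ _ _ (length_factor z i k) h1 h2

/-! ### Transitivity on reduced words -/

section Invariant

variable {B : List (BState n) → Prop}

/-- The last letter of the section of `u ++ [y]` is a bijective function of `y`, so extensions of
`u` in `B` correspond to those of its section. -/
theorem unique_extension_section (hB : ∀ x w, B (D x w) ↔ B w) (x : Fin 2) (u : List (BState n)) :
    (∀ y y', B (D x u ++ [y]) → B (D x u ++ [y']) → y = y') ↔
      ∀ y y', B (u ++ [y]) → B (u ++ [y']) → y = y' := by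
  have h := bellaterra_dual_isInvertible (τ := τ) ((bellaterra n τ).dual.runState x u)
  rw [h.2.forall₂]
  simp only [← MealyAutomaton.run_append_singleton, hB, h.1.eq_iff]

theorem exists_extension_section (hB : ∀ x w, B (D x w) ↔ B w) (x : Fin 2) (u : List (BState n)) :
    (∃ y, B (D x u ++ [y])) ↔ ∃ y, B (u ++ [y]) := by
  have h := bellaterra_dual_isInvertible (τ := τ) ((bellaterra n τ).dual.runState x u)
  rw [h.2.exists]
  simp only [← MealyAutomaton.run_append_singleton, hB]

end Invariant

/-- The infinite word `dadada…`. -/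
def alternating (n i : ℕ) : BState n := if Even i then .d else .a

theorem alternating_add_two (i : ℕ) : alternating n (i + 2) = alternating n i := by
  simp [alternating, Nat.even_add]

theorem alternating_ne_succ (i : ℕ) : alternating n i ≠ alternating n (i + 1) := by
  by_cases h : Even i <;> simp [alternating, Nat.even_add_one, h]

theorem eq_alternating_of_isChain {i k : ℕ} {y : BState n} (hy : y = .a ∨ y = .d)
    (h : (factor (alternating n) i (k + 1) ++ [y]).IsChain (· ≠ ·)) :
    y = alternating n (i + (k + 1)) := by
  rw [factor_succ, List.append_assoc, List.isChain_append] at h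
  have h1 : alternating n (i + k) ≠ y := (List.isChain_cons_cons.1 h.2.1).1
  rw [← add_assoc]
  by_cases hi : Even (i + k) <;> simp only [alternating, Nat.even_add_one, hi] at h1 ⊢ <;>
    rcases hy with rfl | rfl <;> simp_all

theorem isOddWord_alternating : IsOddWord τ 0 (alternating n) where
  periodic := alternating_add_two
  sum_parity := by simp [Finset.sum_range_succ, alternating, parity, bellaterra]
  sum_indicatorAB := by simp [Finset.sum_range_succ, alternating, indicatorAB]

theorem factor_alternating_append_equiv {s : BState n} (hs : ¬(s = .a ∨ s = .d)) (i k : ℕ) :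
    factor (alternating n) i k ++ [s] ≈ₛ factor (alternating n) i k ++ [.b] := by
  have key : ∀ t : BState n, ¬(t = .a ∨ t = .d) → t ∉ factor (alternating n) i k := by
    intro t ht hmem
    obtain ⟨j, rfl⟩ := mem_factor _ hmem
    unfold alternating at ht
    split_ifs at ht <;> simp at ht
  exact append_equiv_append_b (key _ (by simp)) (key _ (by simp)) (key s hs)

/-- If words of length `k + 1` without double letters are all equivalent, then so are those of
length `k + 2`. -/
theorem sectionEquiv_succ {k : ℕ}
    (ih : ∀ u v : List (BState n), u.length = k + 1 → v.length = k + 1 → u.IsChain (· ≠ ·) →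
      v.IsChain (· ≠ ·) → u ≈ₛ v) {w : List (BState n)} (hw : w.length = k + 2)
    (hc : w.IsChain (· ≠ ·)) : w ≈ₛ factor (alternating n) 0 (k + 1) ++ [.b] := by
  by_contra hne
  set v := factor (alternating n) 0 (k + 1) ++ [.b] with hv
  let B : List (BState n) → Prop := fun w =>
    w.length = k + 2 ∧ w.IsChain (· ≠ ·) ∧ ¬w ≈ₛ v
  have hB : ∀ x w, B (D x w) ↔ B w := fun x w => by
    have h := MealyAutomaton.SectionEquiv.run (A := bellaterra n τ) x w
    have h' : D x w ≈ₛ v ↔ w ≈ₛ v := ⟨h.trans, h.symm.trans⟩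
    simp only [B, MealyAutomaton.length_run, isChain_section_iff, h']
  have hchain := isChain_factor (alternating n) alternating_ne_succ
  have hu : ∀ u : List (BState n), u.length = k + 1 → u.IsChain (· ≠ ·) →
      ∀ y y', B (u ++ [y]) → B (u ++ [y']) → y = y' := by
    intro u hlen hu
    have h := ih u _ hlen (length_factor (alternating n) 0 (k + 1)) hu (hchain 0 _)
    rw [h.iff_of_invariant (P := fun u => ∀ y y', B (u ++ [y]) → B (u ++ [y']) → y = y')
      (unique_extension_section hB)]
    have key : ∀ y, B (factor (alternating n) 0 (k + 1) ++ [y]) →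
        y = alternating n (0 + (k + 1)) := fun y hy =>
      eq_alternating_of_isChain (not_not.1 fun h =>
        hy.2.2 (factor_alternating_append_equiv h 0 (k + 1))) hy.2.1
    exact fun y y' hy hy' => (key y hy).trans (key y' hy').symm
  have hex : ∀ u : List (BState n), u.length = k + 1 → u.IsChain (· ≠ ·) → ∃ y, B (u ++ [y]) := by
    intro u hlen hu
    obtain ⟨w, s, rfl⟩ := w.eq_nil_or_concat'.resolve_left (by rintro rfl; simp at hw)
    have h := ih u w hlen (by simpa using hw) hu (List.isChain_append.1 hc).1
    rw [h.iff_of_invariant (P := fun u => ∃ y, B (u ++ [y])) (exists_extension_section hB)]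
    exact ⟨s, hw, hc, hne⟩
  have hfac : ∀ i, B (factor (alternating n) i (k + 1 + 1)) := by
    intro i
    rw [factor_succ]
    have hlen := length_factor (alternating n) i (k + 1)
    obtain ⟨y, hy⟩ := hex _ hlen (hchain i _)
    rw [← eq_alternating_of_isChain (not_not.1 fun h => ?_) hy.2.1]
    · exact hy
    -- A letter outside `a` and `d` would put all such letters in `B` after this factor, among them
    -- `b` and `c`, against uniqueness.
    have hBb : ∀ s : BState n, ¬(s = .a ∨ s = .d) → B (factor (alternating n) i (k + 1) ++ [s]) :=
      fun s hs => (((factor_alternating_append_equiv h i (k + 1)).trans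
        (factor_alternating_append_equiv hs i (k + 1)).symm).iff_of_invariant hB).1 hy
    have := hu _ hlen (hchain i _) _ _ (hBb .b (by simp)) (hBb .c (by simp))
    simp at this
  exact not_deterministic_of_factor (fun x w => (hB x w).2) isOddWord_alternating hfac
    fun u y y' hlen hy => hu u hlen (List.isChain_append.1 hy.2.1).1 y y' hy

/-- Words of states of the same length without double letters are equivalent. -/
theorem sectionEquiv_of_isChain {k : ℕ} {u v : List (BState n)} (hu : u.length = k)
    (hv : v.length = k) (huc : u.IsChain (· ≠ ·)) (hvc : v.IsChain (· ≠ ·)) : u ≈ₛ v := by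
  induction k generalizing u v with
  | zero =>
    rw [List.length_eq_zero_iff] at hu hv
    subst hu hv
    exact .refl _
  | succ k ih =>
    cases k with
    | zero =>
      obtain ⟨s, rfl⟩ := List.length_eq_one_iff.1 hu
      obtain ⟨t, rfl⟩ := List.length_eq_one_iff.1 hv
      have key : ∀ s : BState n, [s] ≈ₛ [.b] := fun s =>
        append_equiv_append_b (u := []) (by simp) (by simp) (by simp)
      exact (key s).trans (key t).symm
    | succ k =>
      have key := fun {w} => sectionEquiv_succ (τ := τ) (k := k)
        (fun u v hu hv huc hvc => ih hu hv huc hvc) (w := w)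
      exact (key hu huc).trans (key hv hvc).symm

/-! ### Nontrivial action and the free product -/

theorem act_singleton {w : List (BState n)} (hw : ∀ s ∈ w, s = .a ∨ s = .b) (x : Fin 2) :
    (bellaterra n τ).act w [x] = [x] := by
  induction w with
  | nil => rfl
  | cons s w ih =>
    have h : (bellaterra n τ).run s [x] = [x] := by
      rcases hw s List.mem_cons_self with rfl | rfl <;> rfl
    rw [MealyAutomaton.act, h, ih fun s hs => hw s (List.mem_cons_of_mem _ hs)]

/-- A nonempty word of states without double letters does not act trivially. -/
theorem not_isTrivialWord_of_isChain {w : List (BState n)} (hne : w ≠ [])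
    (hw : w.IsChain (· ≠ ·)) : ¬(bellaterra n τ).IsTrivialWord w := by
  obtain ⟨k, hk⟩ := Nat.exists_eq_add_one_of_ne_zero (List.length_pos_iff.2 hne).ne'
  -- `a` and `b` fix the first letter, so the swap made by a leading `c` survives.
  let z : ℕ → BState n := fun i => if Even i then .a else .b
  have hz : ∀ i, z i ≠ z (i + 1) := fun i => by
    by_cases h : Even i <;> simp [z, Nat.even_add_one, h]
  have hzab : ∀ i, z i = .a ∨ z i = .b := fun i => by
    by_cases h : Even i <;> simp [z, h]
  have hchain : (BState.c :: factor z 0 k).IsChain (· ≠ ·) := by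
    cases k with
    | zero => exact List.isChain_singleton _
    | succ k =>
      exact List.isChain_cons_cons.2 ⟨by simp [z], isChain_factor z hz 0 (k + 1)⟩
  have h := sectionEquiv_of_isChain (τ := τ) hk (by simp) hw hchain
  rw [h.isTrivialWord_iff bellaterra_dual_isInvertible]
  intro htriv
  have h0 := htriv [0]
  have h1 : (bellaterra n τ).run .c [0] = [1] := rfl
  rw [MealyAutomaton.act, h1, act_singleton] at h0
  · simp at h0
  · intro s hs
    obtain ⟨j, rfl⟩ := mem_factor _ hs
    exact hzab j

theorem statePerm_sq (s : BState n) :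
    (bellaterra n τ).statePerm (bellaterra_isInvertible n τ) s ^ 2 = 1 := by
  ext1 v
  rw [sq]
  exact bellaterra_run_run s v

theorem prod_map_statePerm (w : List (BState n)) (v : List (Fin 2)) :
    (w.map ((bellaterra n τ).statePerm (bellaterra_isInvertible n τ))).prod v =
      (bellaterra n τ).act w.reverse v := by
  induction w generalizing v with
  | nil => rfl
  | cons s w ih =>
    rw [List.map_cons, List.prod_cons, Equiv.Perm.mul_apply, ih, List.reverse_cons,
      MealyAutomaton.act_append]
    rfl

/-- A group generated by a family of involutions in which no nonempty product without equal
adjacent factors is trivial is the free product of groups of order two. -/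
theorem nonempty_closure_mulEquiv_coprodI {G ι : Type*} [Group G] (g : ι → G)
    (hg : ∀ i, g i ^ 2 = 1)
    (hfree : ∀ l : List ι, l.IsChain (· ≠ ·) → (l.map g).prod = 1 → l = []) :
    Nonempty (Subgroup.closure (Set.range g) ≃*
      Monoid.CoprodI (fun _ : ι => Multiplicative (ZMod 2))) := by
  classical
  let φ : ∀ i, Multiplicative (ZMod 2) →* G := fun i =>
    { toFun := fun x => g i ^ x.toAdd.val
      map_one' := by simp
      map_mul' := fun x y => by
        rw [toAdd_mul, ZMod.val_add, ← pow_add, ← pow_eq_pow_mod _ (hg i)] }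
  have hφ : ∀ i (x : Multiplicative (ZMod 2)), x ≠ 1 → φ i x = g i := by
    intro i x hx
    have : x.toAdd.val = 1 := by
      revert x
      decide
    change g i ^ x.toAdd.val = g i
    rw [this, pow_one]
  let f : Monoid.CoprodI (fun _ : ι => Multiplicative (ZMod 2)) →* G := Monoid.CoprodI.lift φ
  have hf : Function.Injective f := by
    refine (injective_iff_map_eq_one f).2 fun x hx => ?_
    obtain ⟨w, rfl⟩ := (Monoid.CoprodI.Word.equiv
      (M := fun _ : ι => Multiplicative (ZMod 2))).symm.surjective x
    change f w.prod = 1 at hx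
    have h1 : f w.prod = ((w.toList.map Sigma.fst).map g).prod := by
      rw [Monoid.CoprodI.Word.prod, map_list_prod, List.map_map, List.map_map]
      congr 1
      refine List.map_congr_left fun l hl => ?_
      simp only [Function.comp_apply, f, Monoid.CoprodI.lift_of]
      exact hφ _ _ (w.ne_one l hl)
    rw [h1] at hx
    have h2 := hfree _ ((List.isChain_map _).2 w.chain_ne) hx
    rw [List.map_eq_nil_iff] at h2
    change w.prod = 1
    rw [Monoid.CoprodI.Word.prod, h2]
    rfl
  have hrange : f.range = Subgroup.closure (Set.range g) := by
    rw [Monoid.CoprodI.range_eq_iSup]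
    refine le_antisymm (iSup_le fun i => ?_) ((Subgroup.closure_le _).2 ?_)
    · rintro _ ⟨x, rfl⟩
      exact pow_mem (Subgroup.subset_closure (Set.mem_range_self i)) _
    · rintro _ ⟨i, rfl⟩
      refine Subgroup.mem_iSup_of_mem i ⟨Multiplicative.ofAdd 1, hφ i _ (by decide)⟩
  exact ⟨((MonoidHom.ofInjective hf).trans (MulEquiv.subgroupCongr hrange)).symm⟩

theorem theorem2 (n : ℕ) (hn : 4 < n) (τ : Fin (n - 4) → Equiv.Perm (Fin 2)) :
    Nonempty ((bellaterra n τ).group (bellaterra_isInvertible n τ) ≃*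
      Monoid.CoprodI (fun _ : Fin n => Multiplicative (ZMod 2))) := by
  let e : Fin n ≃ BState n :=
    (finCongr (by omega)).trans (finSumFinEquiv.symm.trans (BState.equivSum n).symm)
  let g := (bellaterra n τ).statePerm (bellaterra_isInvertible n τ)
  have hrange : Set.range g = Set.range (g ∘ e) := by
    rw [Set.range_comp, e.range_eq_univ, Set.image_univ]
  unfold MealyAutomaton.group
  change Nonempty (Subgroup.closure (Set.range g) ≃* _)
  rw [hrange]
  refine nonempty_closure_mulEquiv_coprodI (g ∘ e) (fun i => statePerm_sq _) fun l hl h => ?_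
  by_contra hne
  rw [← List.map_map] at h
  -- Reversed because a product of permutations applies its last factor first, while `act` starts
  -- with the first state.
  refine not_isTrivialWord_of_isChain (τ := τ) (w := (l.map e).reverse) (by simpa using hne) ?_
    fun v => ?_
  · rw [List.isChain_reverse, List.isChain_map]
    exact hl.imp fun _ _ h => fun h' => h (e.injective h').symm
  · rw [← prod_map_statePerm]
    exact congrArg (· v) h
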